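/- Let $F$ be a field of characteristic $0$, let $D$ be a finite-dimensional central division algebra over $F$ with an involution $\ast$ (an additive anti-automorphism with $a^{\ast\ast}=a$; its restriction to $F$ may be trivial or not), and let $K$ be a maximal $\ast$-invariant subfield of $D$. Equip $D\otimes_F K$ with the involution $(d\otimes k)^\ast=d^\ast\otimes k^\ast$. An involution on a ring $R$ is called formally real if every nonempty finite sum of nonzero elements of the form $rr^\ast$ ($r\in R$) is nonzero; equivalently, $R$ has a unital hermitian cone, that is, a set $M\subseteq\{r\in R: r^\ast=r\}$ with $M+M\subseteq M$, $aMa^\ast\subseteq M$ for all $a\in R$, $M\cap -M=\{0\}$ and $1\in M$. A $\ast$-ordering on $F$ is a unital hermitian cone $P$ on $(F,\ast)$ with $P\cdot P\subseteq P$. For a central simple algebra $A$ with involution over a field $E$, with reduced trace $\operatorname{tr}\colon A\to E$, the hermitian trace form is $a\mapsto \operatorname{tr}(a^\ast a)$; it is called positive semidefinite if the set $S$ of all finite sums of its values satisfies $S\cap -S=\{0\}$. Consider the following assertions: (1) there exists a $\ast$-ordering on $F$ that contains the image of the hermitian trace form of $(D,\ast)$; (2) the hermitian trace form of the central simple $K$-algebra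 $(D\otimes_F K,\ast)$ is positive semidefinite; (3) the hermitian trace form of $(D,\ast)$ is positive semidefinite; (4) $(D\otimes_F K,\ast)$ is formally real; (5) $(D,\ast)$ is formally real. Then $(1)\Rightarrow(2)\Rightarrow(3)\Rightarrow(4)\Rightarrow(5)$. -/

import Mathlib

open scoped TensorProduct

/-- An involution on a ring is formally real if every nonempty finite sum of nonzero elements of the
form `r * star r` is nonzero. -/
def IsFormallyRealInvolution (R : Type*) [Ring R] [StarRing R] : Prop :=
  ∀ (n : ℕ) (r : Fin (n + 1) → R), (∀ i, r i * star (r i) ≠ 0) → ∑ i, r i * star (r i) ≠ 0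

/-- A unital hermitian cone on a ring with involution: a set `M` of symmetric elements with
`M + M ⊆ M`, `a M a* ⊆ M` for every `a`, `M ∩ -M = {0}` and `1 ∈ M`. -/
structure IsUnitalHermitianCone {R : Type*} [Ring R] [StarRing R] (M : Set R) : Prop where
  star_eq : ∀ x ∈ M, star x = x
  add_mem : ∀ x ∈ M, ∀ y ∈ M, x + y ∈ M
  conj_mem : ∀ a : R, ∀ x ∈ M, a * x * star a ∈ M
  inter_neg : {x | x ∈ M ∧ -x ∈ M} = {0}
  one_mem : (1 : R) ∈ M

/-- A `*`-ordering: a multiplicatively closed unital hermitian cone. -/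
structure IsStarOrdering {R : Type*} [Ring R] [StarRing R] (P : Set R) : Prop
    extends IsUnitalHermitianCone P where
  mul_mem : ∀ x ∈ P, ∀ y ∈ P, x * y ∈ P

/-- A ring with involution is formally real if and only if it has a unital hermitian cone. -/
theorem isFormallyRealInvolution_iff_exists_cone (R : Type*) [Ring R] [StarRing R] :
    IsFormallyRealInvolution R ↔ ∃ M : Set R, IsUnitalHermitianCone M := by
  constructor
  · intro h
    let S : Set R := Set.range fun r : R => r * star r
    have key : ∀ l : List R, (∀ r ∈ l, r * star r ≠ 0) →
        (l.map fun r => r * star r).sum = 0 → l = [] := by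
      intro l hl hs
      cases l with
      | nil => rfl
      | cons a t =>
        exfalso
        refine h t.length (fun i => (a :: t).get i) (fun i => hl _ (List.get_mem _ _)) ?_
        rw [← hs, ← List.sum_ofFn]
        congr 1
        apply List.ext_getElem
        · simp
        · intro i _ _
          cases i <;> simp
    have rep : ∀ x ∈ AddSubmonoid.closure S, ∃ l : List R, (∀ r ∈ l, r * star r ≠ 0) ∧
        (l.map fun r => r * star r).sum = x := by
      intro x hx
      induction hx using AddSubmonoid.closure_induction with
      | mem x hx =>
        obtain ⟨r, rfl⟩ := hx
        by_cases h0 : r * star r = 0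
        · exact ⟨[], by simp, by simp [h0]⟩
        · exact ⟨[r], by simpa using h0, by simp⟩
      | zero => exact ⟨[], by simp, by simp⟩
      | add x y _ _ hx hy =>
        obtain ⟨l, hl, rfl⟩ := hx
        obtain ⟨m, hm, rfl⟩ := hy
        refine ⟨l ++ m, ?_, by simp⟩
        intro r hr
        rcases List.mem_append.1 hr with hr | hr
        exacts [hl r hr, hm r hr]
    refine ⟨AddSubmonoid.closure S, ?_, fun x hx y hy => add_mem hx hy, ?_, ?_, ?_⟩
    · intro x hx
      induction hx using AddSubmonoid.closure_induction with
      | mem x hx => obtain ⟨r, rfl⟩ := hx; simp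
      | zero => simp
      | add x y _ _ hx hy => simp [hx, hy]
    · intro a x hx
      induction hx using AddSubmonoid.closure_induction with
      | mem x hx =>
        obtain ⟨r, rfl⟩ := hx
        exact AddSubmonoid.subset_closure ⟨a * r, by simp [mul_assoc]⟩
      | zero => simp
      | add x y _ _ hx hy => rw [mul_add, add_mul]; exact add_mem hx hy
    · ext x
      simp only [Set.mem_ofPred_eq, Set.mem_singleton_iff, SetLike.mem_coe]
      constructor
      · rintro ⟨h1, h2⟩
        obtain ⟨l, hl, hlx⟩ := rep x h1
        obtain ⟨m, hm, hmx⟩ := rep (-x) h2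
        have := key (l ++ m) (by
          intro r hr
          rcases List.mem_append.1 hr with hr | hr
          exacts [hl r hr, hm r hr]) (by simp [hlx, hmx])
        have hl0 := (List.append_eq_nil_iff.1 this).1
        subst hl0
        simpa using hlx.symm
      · rintro rfl
        simp
    · exact AddSubmonoid.subset_closure ⟨1, by simp⟩
  · rintro ⟨M, hM⟩ n r hr hsum
    have hmem : ∀ a : R, a * star a ∈ M := fun a => by
      simpa using hM.conj_mem a 1 hM.one_mem
    have h0 : (0 : R) ∈ M := by simpa using hmem 0
    have hS : ∀ s : Finset (Fin (n + 1)), ∑ i ∈ s, r i * star (r i) ∈ M := by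
      intro s
      classical
      induction s using Finset.induction_on with
      | empty => simpa using h0
      | insert i s hi ih => rw [Finset.sum_insert hi]; exact hM.add_mem _ (hmem _) _ ih
    have h1 : r 0 * star (r 0) = -∑ i : Fin n, r i.succ * star (r i.succ) := by
      rw [Fin.sum_univ_succ] at hsum
      exact eq_neg_of_add_eq_zero_left hsum
    have h2 : -(r 0 * star (r 0)) ∈ M := by
      rw [h1, neg_neg]
      have := hS (Finset.univ.image Fin.succ)
      rwa [Finset.sum_image (fun _ _ _ _ h => Fin.succ_injective _ h)] at this
    have h3 : r 0 * star (r 0) ∈ {x | x ∈ M ∧ -x ∈ M} := ⟨hmem _, h2⟩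
    rw [hM.inter_neg] at h3
    exact hr 0 h3

/-- `c` is the trace of the matrix of `a` in some splitting of the `F`-algebra `A` over the
algebraic closure of `F`. -/
def IsReducedTraceOf (F : Type*) {A : Type*} [Field F] [Ring A] [Algebra F A] (a : A) (c : F) :
    Prop :=
  ∃ (n : ℕ) (φ : AlgebraicClosure F ⊗[F] A ≃ₐ[AlgebraicClosure F]
      Matrix (Fin n) (Fin n) (AlgebraicClosure F)),
    (φ (1 ⊗ₜ[F] a)).trace = algebraMap F (AlgebraicClosure F) c

open Classical in
/-- The reduced trace of a central simple `F`-algebra `A`: the trace of the image of `a` in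
`AlgebraicClosure F ⊗ A ≅ Mₙ(AlgebraicClosure F)`, which lies in `F` and does not depend on the
isomorphism (the value `0` is used only for algebras that are not central simple). -/
noncomputable def reducedTrace (F : Type*) {A : Type*} [Field F] [Ring A] [Algebra F A] (a : A) :
    F :=
  if h : ∃ c : F, IsReducedTraceOf F a c then h.choose else 0

/-- The image of the hermitian trace form `a ↦ tr(a* a)`. -/
def hermitianTraceImage (F A : Type*) [Field F] [Ring A] [StarRing A] [Algebra F A] : Set F :=
  Set.range fun a : A => reducedTrace F (star a * a)

/-- The hermitian trace form is positive semidefinite: the set `S` of finite sums of its values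
satisfies `S ∩ -S = {0}`. -/
def HermitianTracePosSemidef (F A : Type*) [Field F] [Ring A] [StarRing A] [Algebra F A] : Prop :=
  {c : F | c ∈ AddSubmonoid.closure (hermitianTraceImage F A) ∧
    -c ∈ AddSubmonoid.closure (hermitianTraceImage F A)} = {0}

/-- The hermitian trace form of `D ⊗[F] K`, regarded as a `K`-algebra through the second factor and
with the involution `star (d ⊗ₜ k) = star d ⊗ₜ star k`, is positive semidefinite. -/
def ExtendedHermitianTracePosSemidef (F D K : Type*) [Field F] [StarRing F]
    [Ring D] [StarRing D] [Algebra F D] [StarModule F D]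
    [Field K] [StarRing K] [Algebra F K] [StarModule F K] : Prop :=
  letI : Algebra K (D ⊗[F] K) := Algebra.TensorProduct.rightAlgebra
  HermitianTracePosSemidef K (D ⊗[F] K)

/-- The embedding `ι` identifies `K` with a maximal `*`-invariant subfield of `D`. A subfield of `D`
containing `F` is the same as a commutative `F`-subalgebra, as `D` is a finite-dimensional division
algebra over `F`. -/
def IsMaximalStarSubfield {F D K : Type*} [Field F] [StarRing F]
    [DivisionRing D] [StarRing D] [Algebra F D] [StarModule F D]
    [Field K] [StarRing K] [Algebra F K] [StarModule F K] (ι : K →⋆ₐ[F] D) : Prop :=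
  Maximal (fun L : StarSubalgebra F D => ∀ x ∈ L, ∀ y ∈ L, x * y = y * x) ι.range

/-! Write `h(x, y) = tr(x* y)` on `D`. Two facts carry the proof. If the form is positive
semidefinite it is anisotropic (`HermitianTracePosSemidef.eq_zero_of_trace_eq_zero`), because an
isotropic vector would let it represent the negative of a positive value. And `D ⊗ K` acts
faithfully on `D` by `(d ⊗ k) x = d x k`, with the involution of `D ⊗ K` as the adjoint for `h`.

(1) ⇒ (2): anisotropy allows Gram–Schmidt, so `D` is spanned by an `h`-orthogonal set, and the trace
form of `D ⊗ K` takes the values `∑ tr(e* e) k_e* k_e`. The functional `tr ∘ ι` is strictly positive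
on nonzero sums of such terms, which excludes `c` and `-c` together unless `c = 0`.

(2) ⇒ (3) is restriction to `a ⊗ 1`. (3) ⇒ (4): if `∑ r_i r_i* = 0`, then `∑ h(r_i* x, r_i* x) = 0`
for every `x`, so each `r_i*` kills `D` and is zero by faithfulness. (4) ⇒ (5) is restriction along
`d ↦ d ⊗ 1`.

The properties of the reduced trace come from the regular trace: in characteristic zero it is the
regular trace divided by the degree. -/

/-- A tensor product of a field with a central division algebra is a simple ring. -/
theorem isSimpleRing_field_tensor (F L D : Type*) [Field F] [Field L] [Algebra F L]
    [DivisionRing D] [Algebra F D] [Algebra.IsCentral F D] : IsSimpleRing (L ⊗[F] D) := by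
  classical
  let b := Module.Basis.ofVectorSpace F L
  let e := TensorProduct.equivFinsuppOfBasisLeft (N := D) b
  have hr : ∀ (x : L ⊗[F] D) (d : D) i, e (x * (1 ⊗ₜ d)) i = e x i * d := by
    intro x d i
    induction x with
    | zero => simp
    | tmul l y => simp [e]
    | add x y hx hy => simp [add_mul, hx, hy]
  have hl : ∀ (x : L ⊗[F] D) (d : D) i, e ((1 ⊗ₜ d) * x) i = d * e x i := by
    intro x d i
    induction x with
    | zero => simp
    | tmul l y => simp [e]
    | add x y hx hy => simp [mul_add, hx, hy]
  refine IsSimpleRing.of_eq_bot_or_eq_top fun I => ?_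
  by_cases hI : I = ⊥
  · exact Or.inl hI
  right
  -- Shortest-element argument: take a nonzero element of `I` with the fewest nonzero coordinates in
  -- `D`, and scale one coordinate to `1`.
  have hex : ∃ n, ∃ x ∈ I, x ≠ 0 ∧ (e x).support.card = n := by
    by_contra! h
    refine hI (eq_bot_iff.2 fun x hx => (TwoSidedIdeal.mem_bot _).2 ?_)
    by_contra h0
    exact h _ x hx h0 rfl
  obtain ⟨x, hxI, hx0, hxn⟩ := Nat.find_spec hex
  have hmin : ∀ y ∈ I, (e y).support.card < Nat.find hex → y = 0 := by
    intro y hy hlt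
    by_contra h0
    exact Nat.find_min hex hlt ⟨y, hy, h0, rfl⟩
  obtain ⟨i, hi⟩ : ∃ i, e x i ≠ 0 := by
    by_contra! h
    exact hx0 (e.injective (by ext i; simpa using h i))
  let y : L ⊗[F] D := x * (1 ⊗ₜ (e x i)⁻¹)
  have hyI : y ∈ I := I.mul_mem_right _ _ hxI
  have hyi : e y i = 1 := by simp [y, hr, hi]
  have hys : (e y).support ⊆ (e x).support := by
    intro j hj
    simp only [Finsupp.mem_support_iff, y, hr] at hj ⊢
    exact left_ne_zero_of_mul hj
  -- The commutator with `d` has no new coordinates and loses the `i`-th, since `d * 1 - 1 * d = 0`;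
  -- minimality makes it vanish.
  have hcomm : ∀ d : D, (1 ⊗ₜ d) * y - y * (1 ⊗ₜ d) = 0 := by
    intro d
    refine hmin _ (I.sub_mem (I.mul_mem_left _ _ hyI) (I.mul_mem_right _ _ hyI)) ?_
    rw [← hxn]
    refine Finset.card_lt_card ⟨fun j hj => hys ?_, fun hss => ?_⟩
    · simp only [Finsupp.mem_support_iff, map_sub, Finsupp.sub_apply, hr, hl] at hj ⊢
      intro h
      simp [h] at hj
    · have := hss (Finsupp.mem_support_iff.2 hi)
      simp [hr, hl, hyi] at this
  have hcen : ∀ j, ∃ c : F, e y j = algebraMap F D c := by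
    intro j
    have : e y j ∈ Subalgebra.center F D := by
      rw [Subalgebra.mem_center_iff]
      intro d
      rw [← hl, ← hr, sub_eq_zero.1 (hcomm d)]
    obtain ⟨c, hc⟩ := Algebra.mem_bot.1 (Algebra.IsCentral.out this)
    exact ⟨c, hc.symm⟩
  choose c hc using hcen
  -- All coordinates are scalars by centrality, so `y = l ⊗ 1` with `l` a nonzero element of the
  -- field, and `y` is a unit in `I`.
  have hy : y = ((e y).sum fun j _ => c j • b j) ⊗ₜ 1 := by
    refine (e.symm_apply_apply y).symm.trans ?_
    rw [TensorProduct.equivFinsuppOfBasisLeft_symm_apply]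
    simp only [Finsupp.sum, TensorProduct.sum_tmul]
    simp [hc, Algebra.algebraMap_eq_smul_one, TensorProduct.smul_tmul]
  have hl0 : ((e y).sum fun j _ => c j • b j) ≠ 0 := by
    intro h
    rw [h, TensorProduct.zero_tmul] at hy
    simp [hy] at hyi
  refine I.one_mem_iff.1 ?_
  have := I.mul_mem_left (((e y).sum fun j _ => c j • b j)⁻¹ ⊗ₜ 1) _ hyI
  generalize ((e y).sum fun j _ => c j • b j) = l at hy hl0 this
  rw [hy] at this
  simpa [hl0, Algebra.TensorProduct.one_def] using this

/-! ### Regular traces and the reduced trace -/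

theorem Matrix.trace_eq_sum_single {L : Type*} [Field L] {n : ℕ}
    (f : Module.End L (Matrix (Fin n) (Fin n) L)) :
    LinearMap.trace L _ f = ∑ i, ∑ j, f (Matrix.single i j 1) i j := by
  rw [LinearMap.trace_eq_matrix_trace L (Matrix.stdBasis L (Fin n) (Fin n)), Matrix.trace,
    Fintype.sum_prod_type]
  have hrep : ∀ (N : Matrix (Fin n) (Fin n) L) i j,
      (Matrix.stdBasis L (Fin n) (Fin n)).repr N (i, j) = N i j := fun N i j => rfl
  simp only [Matrix.diag_apply, LinearMap.toMatrix_apply, Matrix.stdBasis_eq_single, hrep]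

theorem Matrix.trace_mulLeft {L : Type*} [Field L] {n : ℕ} (M : Matrix (Fin n) (Fin n) L) :
    LinearMap.trace L _ (LinearMap.mulLeft L M) = n * M.trace := by
  simp [Matrix.trace_eq_sum_single, Matrix.trace, Finset.mul_sum]

theorem Matrix.trace_mulRight {L : Type*} [Field L] {n : ℕ} (M : Matrix (Fin n) (Fin n) L) :
    LinearMap.trace L _ (LinearMap.mulRight L M) = n * M.trace := by
  simp [Matrix.trace_eq_sum_single, Matrix.trace]

section Split
variable {E A : Type*} [Field E] [Ring A] [Algebra E A] [FiniteDimensional E A] {n : ℕ}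

theorem mul_self_eq_finrank_of_split
    (φ : AlgebraicClosure E ⊗[E] A ≃ₐ[AlgebraicClosure E]
      Matrix (Fin n) (Fin n) (AlgebraicClosure E)) : n * n = Module.finrank E A := by
  have h1 := φ.toLinearEquiv.finrank_eq
  rw [Module.finrank_baseChange, Module.finrank_matrix] at h1
  simpa using h1.symm

/-- The trace of an endomorphism survives base change and conjugation by `φ`, and on `n × n`
matrices left multiplication by `M` acts as `M` on each of the `n` columns. -/
theorem algebraMap_trace_mulLeft
    (φ : AlgebraicClosure E ⊗[E] A ≃ₐ[AlgebraicClosure E]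
      Matrix (Fin n) (Fin n) (AlgebraicClosure E)) (a : A) :
    algebraMap E (AlgebraicClosure E) (LinearMap.trace E A (LinearMap.mulLeft E a)) =
      n * (φ (1 ⊗ₜ a)).trace := by
  rw [← LinearMap.trace_baseChange, ← Matrix.trace_mulLeft,
    ← LinearMap.trace_conj' _ φ.toLinearEquiv]
  congr 1
  refine LinearMap.ext fun M => ?_
  obtain ⟨x, rfl⟩ := φ.surjective M
  induction x with
  | zero => simp
  | tmul l y => simp [LinearEquiv.conj_apply, ← map_mul]
  | add x y hx hy => rw [map_add, map_add, hx, hy, map_add]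

theorem algebraMap_trace_mulRight
    (φ : AlgebraicClosure E ⊗[E] A ≃ₐ[AlgebraicClosure E]
      Matrix (Fin n) (Fin n) (AlgebraicClosure E)) (a : A) :
    algebraMap E (AlgebraicClosure E) (LinearMap.trace E A (LinearMap.mulRight E a)) =
      n * (φ (1 ⊗ₜ a)).trace := by
  rw [← LinearMap.trace_baseChange, ← Matrix.trace_mulRight,
    ← LinearMap.trace_conj' _ φ.toLinearEquiv]
  congr 1
  refine LinearMap.ext fun M => ?_
  obtain ⟨x, rfl⟩ := φ.surjective M
  induction x with
  | zero => simp
  | tmul l y => simp [LinearEquiv.conj_apply, ← map_mul]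
  | add x y hx hy => rw [map_add, map_add, hx, hy, map_add]

/-- An involution exchanges left and right multiplications; this equality undoes the exchange. -/
theorem trace_mulRight_eq_trace_mulLeft
    (φ : AlgebraicClosure E ⊗[E] A ≃ₐ[AlgebraicClosure E]
      Matrix (Fin n) (Fin n) (AlgebraicClosure E)) (a : A) :
    LinearMap.trace E A (LinearMap.mulRight E a) = LinearMap.trace E A (LinearMap.mulLeft E a) :=
  (algebraMap E (AlgebraicClosure E)).injective <| by
    rw [algebraMap_trace_mulLeft φ, algebraMap_trace_mulRight φ]

/-- In characteristic zero the reduced trace is the regular trace divided by the degree. -/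
theorem mul_reducedTrace_eq_trace [CharZero E] [Nontrivial A]
    (φ : AlgebraicClosure E ⊗[E] A ≃ₐ[AlgebraicClosure E]
      Matrix (Fin n) (Fin n) (AlgebraicClosure E)) (m : ℕ)
    (hm : m * m = Module.finrank E A) (a : A) :
    m * reducedTrace E a = LinearMap.trace E A (LinearMap.mulLeft E a) := by
  have hinj := (algebraMap E (AlgebraicClosure E)).injective
  have hm0 : m ≠ 0 := by
    rintro rfl
    exact Module.finrank_pos.ne hm
  have hcast : (m : E) ≠ 0 := Nat.cast_ne_zero.2 hm0
  have hcast' : (m : AlgebraicClosure E) ≠ 0 := by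
    rw [← map_natCast (algebraMap E (AlgebraicClosure E))]
    exact (map_ne_zero _).2 hcast
  have hdeg : ∀ {k : ℕ}, k * k = Module.finrank E A → (k : AlgebraicClosure E) = m := fun h =>
    congrArg _ (Nat.mul_self_inj.1 (h.trans hm.symm))
  have hex : ∃ c : E, IsReducedTraceOf E a c := by
    refine ⟨(m : E)⁻¹ * LinearMap.trace E A (LinearMap.mulLeft E a), n, φ, ?_⟩
    rw [map_mul, algebraMap_trace_mulLeft φ, hdeg (mul_self_eq_finrank_of_split φ), map_inv₀,
      map_natCast, inv_mul_cancel_left₀ hcast']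
  have hred : reducedTrace E a = hex.choose := by rw [reducedTrace, dif_pos hex]
  -- The chosen value may come from a splitting other than `φ`, but the dimension forces its size
  -- `k` to equal `m`.
  obtain ⟨k, ψ, hψ⟩ := hex.choose_spec
  apply hinj
  rw [hred, map_mul, ← hψ, algebraMap_trace_mulLeft ψ, hdeg (mul_self_eq_finrank_of_split ψ),
    map_natCast]

end Split

/-- The regular traces of `a` and `star a` are related by the involution of the base field. -/
theorem trace_mulLeft_star {F A : Type*} [Field F] [StarRing F] [Ring A] [StarRing A]
    [Algebra F A] [StarModule F A] [FiniteDimensional F A] (a : A) :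
    LinearMap.trace F A (LinearMap.mulLeft F (star a)) =
      star (LinearMap.trace F A (LinearMap.mulRight F a)) := by
  classical
  let b := Module.finBasis F A
  -- Coordinates for the basis `star (b i)`: applying `star` before and after makes the map linear
  -- rather than semilinear. In this basis `star a * ·` has the conjugated matrix of `· * a` in `b`.
  let e : A ≃ₗ[F] (Fin (Module.finrank F A) → F) :=
    { toFun := fun x i => star (b.equivFun (star x) i)
      invFun := fun f => star (b.equivFun.symm fun i => star (f i))
      map_add' := fun x y => by ext i; simp
      map_smul' := fun c x => by ext i; simp
      left_inv := fun x => by simp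
      right_inv := fun f => by
        ext i
        beta_reduce
        rw [star_star, b.equivFun.apply_symm_apply, star_star] }
  let b' := Module.Basis.ofEquivFun e
  have hb' : ∀ i, b' i = star (b i) := fun i => by
    apply e.injective
    ext j
    rw [Module.Basis.coe_ofEquivFun, e.apply_symm_apply]
    simp [e, Finsupp.single_apply, Pi.single_apply, apply_ite star, eq_comm]
  rw [LinearMap.trace_eq_matrix_trace F b', LinearMap.trace_eq_matrix_trace F b]
  simp only [Matrix.trace, Matrix.diag_apply, LinearMap.toMatrix_apply, star_sum, hb',
    LinearMap.mulLeft_apply, LinearMap.mulRight_apply, ← star_mul]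
  refine Finset.sum_congr rfl fun i _ => ?_
  change star (b.equivFun (star (star (b i * a))) i) = _
  rw [star_star, Module.Basis.equivFun_apply]

/-! ### The reduced trace of a central division algebra -/

section CentralDivision
variable {F D : Type*} [Field F] [DivisionRing D] [Algebra F D] [FiniteDimensional F D]
  [Algebra.IsCentral F D]

theorem exists_split_of_isAlgClosed (F D L : Type*) [Field F] [DivisionRing D] [Algebra F D]
    [FiniteDimensional F D] [Algebra.IsCentral F D] [Field L] [IsAlgClosed L] [Algebra F L] :
    ∃ n : ℕ, Nonempty (L ⊗[F] D ≃ₐ[L] Matrix (Fin n) (Fin n) L) := by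
  have := isSimpleRing_field_tensor F L D
  obtain ⟨n, _, h⟩ := IsSimpleRing.exists_algEquiv_matrix_of_isAlgClosed L (L ⊗[F] D)
  exact ⟨n, h⟩

theorem exists_degree (F D : Type*) [Field F] [DivisionRing D] [Algebra F D]
    [FiniteDimensional F D] [Algebra.IsCentral F D] :
    ∃ n : ℕ, n ≠ 0 ∧ n * n = Module.finrank F D := by
  obtain ⟨n, ⟨φ⟩⟩ := exists_split_of_isAlgClosed F D (AlgebraicClosure F)
  have h := mul_self_eq_finrank_of_split φ
  refine ⟨n, ?_, h⟩
  rintro rfl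
  exact Module.finrank_pos.ne h

theorem mul_reducedTrace [CharZero F] {n : ℕ} (hn : n * n = Module.finrank F D) (a : D) :
    n * reducedTrace F a = LinearMap.trace F D (LinearMap.mulLeft F a) := by
  obtain ⟨_, ⟨φ⟩⟩ := exists_split_of_isAlgClosed F D (AlgebraicClosure F)
  exact mul_reducedTrace_eq_trace φ n hn a

/-- The reduced trace of a central division algebra as a linear map. -/
noncomputable def reducedTraceMap (F D : Type*) [Field F] [CharZero F] [DivisionRing D]
    [Algebra F D] [FiniteDimensional F D] [Algebra.IsCentral F D] : D →ₗ[F] F where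
  toFun := reducedTrace F
  map_add' a b := by
    obtain ⟨n, h0, hn⟩ := exists_degree F D
    refine mul_left_cancel₀ (Nat.cast_ne_zero.2 h0 : (n : F) ≠ 0) ?_
    rw [mul_add, mul_reducedTrace hn, mul_reducedTrace hn, mul_reducedTrace hn, ← map_add]
    congr 1
    ext x
    simp [add_mul]
  map_smul' c a := by
    obtain ⟨n, h0, hn⟩ := exists_degree F D
    refine mul_left_cancel₀ (Nat.cast_ne_zero.2 h0 : (n : F) ≠ 0) ?_
    rw [RingHom.id_apply, mul_smul_comm, mul_reducedTrace hn, mul_reducedTrace hn, ← map_smul]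
    congr 1
    ext x
    simp

variable [CharZero F]

theorem reducedTraceMap_apply (a : D) : reducedTraceMap F D a = reducedTrace F a := rfl

theorem reducedTraceMap_mul_comm (a b : D) :
    reducedTraceMap F D (a * b) = reducedTraceMap F D (b * a) := by
  obtain ⟨n, h0, hn⟩ := exists_degree F D
  refine mul_left_cancel₀ (Nat.cast_ne_zero.2 h0 : (n : F) ≠ 0) ?_
  rw [reducedTraceMap_apply, reducedTraceMap_apply, mul_reducedTrace hn, mul_reducedTrace hn,
    LinearMap.mulLeft_mul, LinearMap.mulLeft_mul]
  exact LinearMap.trace_mul_comm F _ _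

theorem exists_reducedTraceMap_one :
    ∃ n : ℕ, n ≠ 0 ∧ reducedTraceMap F D 1 = n := by
  obtain ⟨n, h0, hn⟩ := exists_degree F D
  refine ⟨n, h0, mul_left_cancel₀ (Nat.cast_ne_zero.2 h0 : (n : F) ≠ 0) ?_⟩
  rw [reducedTraceMap_apply, mul_reducedTrace hn, LinearMap.mulLeft_one, LinearMap.trace_id, ← hn,
    Nat.cast_mul]

theorem reducedTraceMap_star [StarRing F] [StarRing D] [StarModule F D] (a : D) :
    reducedTraceMap F D (star a) = star (reducedTraceMap F D a) := by
  obtain ⟨n, h0, hn⟩ := exists_degree F D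
  obtain ⟨_, ⟨φ⟩⟩ := exists_split_of_isAlgClosed F D (AlgebraicClosure F)
  refine mul_left_cancel₀ (Nat.cast_ne_zero.2 h0 : (n : F) ≠ 0) ?_
  rw [reducedTraceMap_apply, mul_reducedTrace hn, trace_mulLeft_star,
    trace_mulRight_eq_trace_mulLeft φ, ← mul_reducedTrace hn, star_mul', star_natCast]
  rfl

/-- The reduced trace is compatible with extension of scalars. -/
theorem reducedTrace_tensor {K : Type*} [Field K] [Algebra F K] (x : D ⊗[F] K) :
    letI : Algebra K (D ⊗[F] K) := Algebra.TensorProduct.rightAlgebra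
    reducedTrace K x = TensorProduct.lid F K ((reducedTraceMap F D).rTensor K x) := by
  let : Algebra K (D ⊗[F] K) := Algebra.TensorProduct.rightAlgebra
  have : CharZero K := charZero_of_injective_algebraMap (algebraMap F K).injective
  let e : K ⊗[F] D ≃ₐ[K] D ⊗[F] K := Algebra.TensorProduct.commRight F K D
  have : FiniteDimensional K (D ⊗[F] K) := Module.Finite.equiv e.toLinearEquiv
  have : Nontrivial (D ⊗[F] K) := e.injective.nontrivial
  -- A splitting of `D` over the algebraic closure of `K` also splits `D ⊗ K` over `K`, by
  -- cancelling the base change.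
  obtain ⟨m, ⟨φ⟩⟩ := exists_split_of_isAlgClosed F D (AlgebraicClosure K)
  let c : AlgebraicClosure K ⊗[K] (K ⊗[F] D) ≃ₐ[AlgebraicClosure K] AlgebraicClosure K ⊗[F] D :=
    AlgEquiv.symm <| AlgEquiv.ofLinearEquiv
      (TensorProduct.AlgebraTensorModule.cancelBaseChange F K (AlgebraicClosure K)
        (AlgebraicClosure K) D).symm
      (by simp [Algebra.TensorProduct.one_def])
      (LinearMap.map_mul_of_map_mul_tmul fun _ _ _ _ => by simp)
  let c' : AlgebraicClosure K ⊗[K] (D ⊗[F] K) ≃ₐ[AlgebraicClosure K]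
      AlgebraicClosure K ⊗[K] (K ⊗[F] D) :=
    Algebra.TensorProduct.congr AlgEquiv.refl e.symm
  let ψ := (c'.trans c).trans φ
  obtain ⟨n, h0, hn⟩ := exists_degree F D
  have hn' : n * n = Module.finrank K (D ⊗[F] K) := by
    rw [hn, ← e.toLinearEquiv.finrank_eq, Module.finrank_baseChange]
  refine mul_left_cancel₀ (Nat.cast_ne_zero.2 h0 : (n : K) ≠ 0) ?_
  rw [mul_reducedTrace_eq_trace ψ n hn']
  induction x with
  | zero => simp
  | add x y hx hy =>
    rw [map_add, map_add, mul_add, ← hx, ← hy, ← map_add]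
    congr 1
    ext z
    simp [add_mul]
  | tmul d k =>
    -- Up to swapping the factors, left multiplication by `d ⊗ k` is `k` times the base change of
    -- left multiplication by `d`, so its trace is read off over `F`.
    have h1 : LinearMap.mulLeft K (d ⊗ₜ[F] k) =
        k • e.toLinearEquiv.conj ((LinearMap.mulLeft F d).baseChange K) := by
      refine LinearMap.ext fun z => ?_
      induction z with
      | zero => simp
      | add x y hx hy => rw [map_add, map_add, hx, hy]
      | tmul d' k' =>
        rw [LinearMap.smul_apply, Algebra.smul_def]
        simp [LinearEquiv.conj_apply, e, Algebra.TensorProduct.right_algebraMap_apply,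
          Algebra.TensorProduct.commRight]
    rw [h1, map_smul, LinearMap.trace_conj', LinearMap.trace_baseChange, ← mul_reducedTrace hn]
    simp [reducedTraceMap_apply, Algebra.smul_def]
    ring

end CentralDivision

/-! ### Anisotropy and orthogonalization of the hermitian trace form -/

theorem reducedTraceMap_mem_closure {F D : Type*} [Field F] [CharZero F]
    [DivisionRing D] [StarRing D] [Algebra F D] [FiniteDimensional F D] [Algebra.IsCentral F D]
    (a : D) :
    reducedTraceMap F D (star a * a) ∈ AddSubmonoid.closure (hermitianTraceImage F D) :=
  AddSubmonoid.subset_closure ⟨a, rfl⟩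

theorem hermitianTracePosSemidef_of_subset_cone {F A : Type*} [Field F] [StarRing F] [Ring A]
    [StarRing A] [Algebra F A] {P : Set F} (hP : IsUnitalHermitianCone P)
    (h : hermitianTraceImage F A ⊆ P) : HermitianTracePosSemidef F A := by
  have h0 : (0 : F) ∈ P := by simpa using hP.conj_mem 0 1 hP.one_mem
  have hle : ∀ x ∈ AddSubmonoid.closure (hermitianTraceImage F A), x ∈ P := by
    intro x hx
    induction hx using AddSubmonoid.closure_induction with
    | mem x hx => exact h hx
    | zero => exact h0
    | add x y _ _ hx hy => exact hP.add_mem x hx y hy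
  refine Set.Subset.antisymm ?_ ?_
  · rintro c ⟨h1, h2⟩
    rw [← hP.inter_neg]
    exact ⟨hle _ h1, hle _ h2⟩
  · rintro c rfl
    simp

section HermitianTraceForm
variable {F D : Type*} [Field F] [CharZero F] [StarRing F] [DivisionRing D] [StarRing D]
  [Algebra F D] [StarModule F D] [FiniteDimensional F D] [Algebra.IsCentral F D]

/-- A positive semidefinite hermitian trace form of a division algebra is anisotropic. -/
theorem HermitianTracePosSemidef.eq_zero_of_trace_eq_zero (h : HermitianTracePosSemidef F D)
    {a : D} (ha : reducedTraceMap F D (star a * a) = 0) : a = 0 := by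
  by_contra h0
  obtain ⟨n, hn0, hn⟩ := exists_reducedTraceMap_one (F := F) (D := D)
  have hnF : (n : F) ≠ 0 := Nat.cast_ne_zero.2 hn0
  -- Chosen so that `star b * a = 1`: then `a` is isotropic with `h(b, a) = h(a, b) = n`.
  let b : D := star a⁻¹
  have hba : reducedTraceMap F D (star b * a) = n := by simp [b, h0, hn]
  have hab : reducedTraceMap F D (star a * b) = n := by
    rw [← star_star b, ← star_mul, reducedTraceMap_star, hba, star_natCast]
  let t := reducedTraceMap F D (star b * b)
  have ht : star t = t := by simp only [t]; rw [← reducedTraceMap_star, star_mul, star_star]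
  -- Solves `h(c a + b, c a + b) = 2 n c + t = -n`; since `n = h(1, 1)` is also a value,
  -- semidefiniteness is contradicted.
  let c : F := -(n + t) / (2 * n)
  have hc : star c = c := by simp [c, ht, star_div₀]
  have hmem : -(n : F) ∈ AddSubmonoid.closure (hermitianTraceImage F D) := by
    convert reducedTraceMap_mem_closure (F := F) (c • a + b) using 1
    rw [star_add, star_smul, hc, add_mul, mul_add, mul_add]
    simp only [smul_mul_assoc, mul_smul_comm, map_add, map_smul, ha, hab, hba, smul_eq_mul]
    change _ = _ + (_ + t)
    simp only [c]
    field_simp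
    ring
  have hmem' : (n : F) ∈ AddSubmonoid.closure (hermitianTraceImage F D) := by
    simpa [hn] using reducedTraceMap_mem_closure (F := F) (1 : D)
  have : (n : F) ∈ ({0} : Set F) := by rw [← h]; exact ⟨hmem', hmem⟩
  exact hnF this

/-- A sum of values of a positive semidefinite hermitian trace form vanishes only trivially. -/
theorem HermitianTracePosSemidef.eq_zero_of_sum_eq_zero (h : HermitianTracePosSemidef F D)
    {ι : Type*} {s : Finset ι} {a : ι → D}
    (hs : ∑ i ∈ s, reducedTraceMap F D (star (a i) * a i) = 0) {i : ι} (hi : i ∈ s) :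
    a i = 0 := by
  classical
  apply h.eq_zero_of_trace_eq_zero
  have hmem : reducedTraceMap F D (star (a i) * a i) ∈ ({0} : Set F) := by
    rw [← h]
    refine ⟨reducedTraceMap_mem_closure _, ?_⟩
    rw [← Finset.add_sum_erase s _ hi] at hs
    rw [neg_eq_of_add_eq_zero_right hs]
    exact sum_mem fun j _ => reducedTraceMap_mem_closure _
  exact hmem

/-- Gram–Schmidt orthogonalization for an anisotropic hermitian trace form. -/
theorem HermitianTracePosSemidef.exists_orthogonal (h : HermitianTracePosSemidef F D)
    (s : Finset D) :
    ∃ t : Finset D, (∀ x ∈ t, ∀ y ∈ t, x ≠ y → reducedTraceMap F D (star x * y) = 0) ∧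
      (s : Set D) ⊆ Submodule.span F (t : Set D) := by
  classical
  induction s using Finset.induction_on with
  | empty => exact ⟨∅, by simp, by simp⟩
  | insert d s _ ih =>
    obtain ⟨t, ht, hst⟩ := ih
    let q : D → F := fun e => reducedTraceMap F D (star e * d) / reducedTraceMap F D (star e * e)
    let p : D := ∑ e ∈ t, q e • e
    have hp : p ∈ Submodule.span F (t : Set D) :=
      sum_mem fun e he => Submodule.smul_mem _ _ (Submodule.subset_span he)
    have horth : ∀ x ∈ t, reducedTraceMap F D (star x * (d - p)) = 0 := by
      intro x hx
      have hxp : reducedTraceMap F D (star x * p) = reducedTraceMap F D (star x * d) := by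
        simp only [p, Finset.mul_sum, mul_smul_comm, map_sum, map_smul, smul_eq_mul]
        rw [Finset.sum_eq_single x (fun e he hne => by rw [ht x hx e he hne.symm, mul_zero])
          (fun hx' => absurd hx hx')]
        -- The orthogonal set may contain `0`, where the quotient `q` has denominator zero;
        -- elsewhere anisotropy makes the denominator nonzero.
        by_cases hx0 : x = 0
        · simp [hx0]
        · exact div_mul_cancel₀ _ fun h0 => hx0 (h.eq_zero_of_trace_eq_zero h0)
      rw [mul_sub, map_sub, hxp, sub_self]
    have horth' : ∀ x ∈ t, reducedTraceMap F D (star (d - p) * x) = 0 := by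
      intro x hx
      rw [← star_star x, ← star_mul, reducedTraceMap_star, horth x hx, star_zero]
    refine ⟨insert (d - p) t, ?_, ?_⟩
    · intro x hx y hy hxy
      rcases Finset.mem_insert.1 hx with rfl | hx <;> rcases Finset.mem_insert.1 hy with rfl | hy
      · exact absurd rfl hxy
      · exact horth' y hy
      · exact horth x hx
      · exact ht x hx y hy hxy
    · have hle : Submodule.span F (t : Set D) ≤
          Submodule.span F ((insert (d - p) t : Finset D) : Set D) :=
        Submodule.span_mono (by simp)
      rw [Finset.coe_insert, Set.insert_subset_iff]
      refine ⟨?_, hst.trans hle⟩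
      have hdp : d - p ∈ Submodule.span F ((insert (d - p) t : Finset D) : Set D) :=
        Submodule.subset_span (by simp)
      simpa only [sub_add_cancel, SetLike.mem_coe] using add_mem hdp (hle hp)

theorem HermitianTracePosSemidef.exists_orthogonal_span_eq_top
    (h : HermitianTracePosSemidef F D) :
    ∃ t : Finset D, (∀ x ∈ t, ∀ y ∈ t, x ≠ y → reducedTraceMap F D (star x * y) = 0) ∧
      Submodule.span F (t : Set D) = ⊤ := by
  obtain ⟨s, hs⟩ := (Module.Finite.fg_top : (⊤ : Submodule F D).FG)
  obtain ⟨t, ht, hst⟩ := h.exists_orthogonal s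
  exact ⟨t, ht, top_le_iff.1 (hs ▸ Submodule.span_le.2 hst)⟩

end HermitianTraceForm

/-- Only spanning is used, so the orthogonal set need not be a basis. -/
theorem TensorProduct.exists_sum_tmul_of_span_eq_top {F M K : Type*} [CommRing F]
    [AddCommGroup M] [Module F M] [AddCommGroup K] [Module F K] {t : Finset M}
    (ht : Submodule.span F (t : Set M) = ⊤) (x : M ⊗[F] K) :
    ∃ k : M → K, x = ∑ e ∈ t, e ⊗ₜ k e := by
  induction x with
  | zero => exact ⟨0, by simp⟩
  | add x y hx hy =>
    obtain ⟨k, rfl⟩ := hx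
    obtain ⟨l, rfl⟩ := hy
    exact ⟨k + l, by simp [TensorProduct.tmul_add, Finset.sum_add_distrib]⟩
  | tmul d k =>
    obtain ⟨c, -, hc⟩ := Submodule.mem_span_finset.1 (ht ▸ Submodule.mem_top :
      d ∈ Submodule.span F (t : Set M))
    exact ⟨fun e => c e • k, by simp [← hc, TensorProduct.sum_tmul, TensorProduct.smul_tmul]⟩

/-! ### The action of `D ⊗ K` on `D` -/

section BimoduleAction
variable {F D K : Type*} [Field F] [DivisionRing D] [Star D] [Algebra F D]
  [Field K] [Star K] [Algebra F K]

/-- `D ⊗ K` acts on `D` by left multiplication with `D` and right multiplication with `K`. -/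
noncomputable def bimoduleAction (ι : K →⋆ₐ[F] D) : D ⊗[F] K →ₐ[F] Module.End F D :=
  Algebra.TensorProduct.lift (Algebra.lmul F D)
    (AlgHom.ofLinearMap ((LinearMap.mul F D).flip ∘ₗ ι.toAlgHom.toLinearMap)
      (by ext; simp)
      (fun k l => by
        ext x
        -- Right multiplication reverses products; commutativity of `K` makes it a homomorphism.
        rw [mul_comm k l]
        simp [mul_assoc]))
    (fun d k => by
      refine LinearMap.ext fun x => ?_
      simp [mul_assoc])

@[simp]
theorem bimoduleAction_tmul (ι : K →⋆ₐ[F] D) (d : D) (k : K) (x : D) :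
    bimoduleAction ι (d ⊗ₜ k) x = d * (x * ι k) := by
  rw [bimoduleAction]
  exact congrArg (fun f : Module.End F D => f x) (Algebra.TensorProduct.lift_tmul ..)

/-- The kernel is a proper two-sided ideal of the simple ring `D ⊗ K`. -/
theorem bimoduleAction_injective [Algebra.IsCentral F D] (ι : K →⋆ₐ[F] D) :
    Function.Injective (bimoduleAction ι) := by
  have : IsSimpleRing (D ⊗[F] K) :=
    IsSimpleRing.of_ringEquiv (Algebra.TensorProduct.comm F K D).toRingEquiv
      (isSimpleRing_field_tensor F K D)
  exact (bimoduleAction ι).toRingHom.injective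

end BimoduleAction

/-! ### The four implications -/

section Implications
variable {F D K : Type*} [Field F] [StarRing F] [DivisionRing D] [StarRing D]
  [Algebra F D] [StarModule F D] [FiniteDimensional F D] [Algebra.IsCentral F D]
  [Field K] [StarRing K] [Algebra F K] [StarModule F K]

theorem extendedHermitianTracePosSemidef_of_isStarOrdering [CharZero F] (ι : K →⋆ₐ[F] D)
    {P : Set F} (hP : IsStarOrdering P) (hDP : hermitianTraceImage F D ⊆ P) :
    ExtendedHermitianTracePosSemidef F D K := by
  have hD : HermitianTracePosSemidef F D :=
    hermitianTracePosSemidef_of_subset_cone hP.toIsUnitalHermitianCone hDP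
  have h0 : (0 : F) ∈ P := by simpa using hP.conj_mem 0 1 hP.one_mem
  have hinter : ∀ x ∈ P, -x ∈ P → x = 0 := fun x h1 h2 => by
    have : x ∈ ({0} : Set F) := by rw [← hP.inter_neg]; exact ⟨h1, h2⟩
    exact this
  -- The functional `lam` transfers positivity from `K` to `F`: it sends `p k* k` to `p h(ι k, ι
  -- k)`, which is in `P` because `P` is multiplicatively closed, and vanishes only if `p = 0` or `k
  -- = 0`.
  let lam : K →ₗ[F] F := reducedTraceMap F D ∘ₗ ι.toAlgHom.toLinearMap
  let S : Set K := {c | ∃ p ∈ P, ∃ k : K, c = algebraMap F K p * (star k * k)}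
  have hS : ∀ c ∈ AddSubmonoid.closure S, lam c ∈ P ∧ (lam c = 0 → c = 0) := by
    intro c hc
    induction hc using AddSubmonoid.closure_induction with
    | mem c hc =>
      obtain ⟨p, hp, k, rfl⟩ := hc
      have hlam : lam (algebraMap F K p * (star k * k)) =
          p * reducedTraceMap F D (star (ι k) * ι k) := by
        rw [← Algebra.smul_def, map_smul, smul_eq_mul]
        refine congrArg (fun z => p * reducedTraceMap F D z) ?_
        exact (map_mul ι _ _).trans (congrArg (· * ι k) (map_star ι k))
      rw [hlam]
      refine ⟨hP.mul_mem _ hp _ (hDP ⟨ι k, rfl⟩), fun h => ?_⟩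
      rcases mul_eq_zero.1 h with h | h
      · simp [h]
      · have : ι k = 0 := hD.eq_zero_of_trace_eq_zero h
        rw [(map_eq_zero ι).1 this]
        simp
    | zero => simpa using h0
    | add x y _ _ hx hy =>
      rw [map_add]
      refine ⟨hP.add_mem _ hx.1 _ hy.1, fun h => ?_⟩
      have hx0 : lam x = 0 := hinter _ hx.1 (by rw [neg_eq_of_add_eq_zero_right h]; exact hy.1)
      rw [hx0, zero_add] at h
      rw [hx.2 hx0, hy.2 h, add_zero]
  obtain ⟨t, ht, htop⟩ := hD.exists_orthogonal_span_eq_top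
  let : Algebra K (D ⊗[F] K) := Algebra.TensorProduct.rightAlgebra
  have himage : hermitianTraceImage K (D ⊗[F] K) ⊆ AddSubmonoid.closure S := by
    rintro _ ⟨x, rfl⟩
    obtain ⟨k, rfl⟩ := TensorProduct.exists_sum_tmul_of_span_eq_top htop x
    -- Orthogonality removes the cross terms, leaving a diagonal form with coefficients `h(e, e)` in
    -- `P`.
    have : reducedTrace K (star (∑ e ∈ t, e ⊗ₜ[F] k e) * ∑ e ∈ t, e ⊗ₜ[F] k e) =
        ∑ e ∈ t, algebraMap F K (reducedTraceMap F D (star e * e)) * (star (k e) * k e) := by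
      rw [reducedTrace_tensor, star_sum, Finset.sum_mul_sum]
      simp only [map_sum, TensorProduct.star_tmul, Algebra.TensorProduct.tmul_mul_tmul,
        LinearMap.rTensor_tmul, TensorProduct.lid_tmul]
      refine Finset.sum_congr rfl fun e he => ?_
      rw [Finset.sum_eq_single e (fun e' he' hne => by rw [ht e he e' he' hne.symm, zero_smul])
        (fun he' => absurd he he'), Algebra.smul_def]
    change reducedTrace K _ ∈ _
    rw [this]
    exact sum_mem fun e _ => AddSubmonoid.subset_closure ⟨_, hDP ⟨e, rfl⟩, k e, rfl⟩
  have hle := AddSubmonoid.closure_le.2 himage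
  change {c : K | c ∈ AddSubmonoid.closure (hermitianTraceImage K (D ⊗[F] K)) ∧
    -c ∈ AddSubmonoid.closure (hermitianTraceImage K (D ⊗[F] K))} = {0}
  refine Set.Subset.antisymm ?_ ?_
  · rintro c ⟨h1, h2⟩
    have hc := hS c (hle h1)
    have hc' := hS _ (hle h2)
    rw [map_neg] at hc'
    exact hc.2 (hinter _ hc.1 hc'.1)
  · rintro c rfl
    simp

theorem HermitianTracePosSemidef.of_extended [CharZero F]
    (h : ExtendedHermitianTracePosSemidef F D K) : HermitianTracePosSemidef F D := by
  let : Algebra K (D ⊗[F] K) := Algebra.TensorProduct.rightAlgebra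
  have h' : {c : K | c ∈ AddSubmonoid.closure (hermitianTraceImage K (D ⊗[F] K)) ∧
    -c ∈ AddSubmonoid.closure (hermitianTraceImage K (D ⊗[F] K))} = {0} := h
  have hmap : ∀ c ∈ AddSubmonoid.closure (hermitianTraceImage F D),
      algebraMap F K c ∈ AddSubmonoid.closure (hermitianTraceImage K (D ⊗[F] K)) := by
    intro c hc
    induction hc using AddSubmonoid.closure_induction with
    | mem c hc =>
      obtain ⟨a, rfl⟩ := hc
      refine AddSubmonoid.subset_closure ⟨a ⊗ₜ 1, ?_⟩
      change reducedTrace K _ = _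
      rw [reducedTrace_tensor]
      simp [reducedTraceMap_apply, Algebra.algebraMap_eq_smul_one]
    | zero => simp
    | add x y _ _ hx hy => rw [map_add]; exact add_mem hx hy
  refine Set.Subset.antisymm ?_ ?_
  · rintro c ⟨h1, h2⟩
    have : algebraMap F K c ∈ ({0} : Set K) := by
      rw [← h']
      exact ⟨hmap _ h1, by rw [← map_neg]; exact hmap _ h2⟩
    exact (map_eq_zero _).1 this
  · rintro c rfl
    simp

/-- The involution of `D ⊗ K` is adjoint to the hermitian trace form of `D`. -/
theorem reducedTraceMap_bimoduleAction [CharZero F] (ι : K →⋆ₐ[F] D) (r : D ⊗[F] K) (x y : D) :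
    reducedTraceMap F D (star x * bimoduleAction ι r y) =
      reducedTraceMap F D (star (bimoduleAction ι (star r) x) * y) := by
  induction r with
  | zero => simp
  | add r s hr hs => simp [mul_add, add_mul, hr, hs]
  | tmul d k =>
    simp only [TensorProduct.star_tmul, bimoduleAction_tmul, star_mul, map_star, star_star]
    rw [← mul_assoc, ← mul_assoc, reducedTraceMap_mul_comm]
    simp only [mul_assoc]

theorem HermitianTracePosSemidef.isFormallyReal_tensor [CharZero F]
    (h : HermitianTracePosSemidef F D) (ι : K →⋆ₐ[F] D) :
    IsFormallyRealInvolution (D ⊗[F] K) := by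
  intro n r hr hsum
  have hzero : ∀ i x, bimoduleAction ι (star (r i)) x = 0 := by
    intro i x
    refine h.eq_zero_of_sum_eq_zero (s := Finset.univ)
      (a := fun i => bimoduleAction ι (star (r i)) x) ?_ (Finset.mem_univ i)
    -- Pairing the vanishing sum with `x` on both sides turns it, by adjointness, into `∑ h(r_i* x,
    -- r_i* x) = 0`.
    have := congrArg (fun z => reducedTraceMap F D (star x * bimoduleAction ι z x)) hsum
    simp only [map_sum, map_mul, LinearMap.sum_apply, Finset.mul_sum, Module.End.mul_apply,
      map_zero, LinearMap.zero_apply, mul_zero] at this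
    rw [← this]
    exact Finset.sum_congr rfl fun i _ => (reducedTraceMap_bimoduleAction ι (r i) x _).symm
  refine hr 0 ?_
  have : star (r 0) = 0 := bimoduleAction_injective ι (by ext x; simp [hzero])
  rw [this, mul_zero]

end Implications

theorem IsFormallyRealInvolution.of_tensor {F D K : Type*} [Field F] [StarRing F]
    [DivisionRing D] [StarRing D] [Algebra F D] [StarModule F D]
    [Field K] [StarRing K] [Algebra F K] [StarModule F K]
    (h : IsFormallyRealInvolution (D ⊗[F] K)) :
    IsFormallyRealInvolution D := by
  have hinj : Function.Injective (Algebra.TensorProduct.includeLeft : D →ₐ[F] D ⊗[F] K) :=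
    Algebra.TensorProduct.includeLeft_injective (algebraMap F K).injective
  have hmap : ∀ d : D, (d ⊗ₜ[F] (1 : K)) * star (d ⊗ₜ[F] (1 : K)) =
      (Algebra.TensorProduct.includeLeft : D →ₐ[F] D ⊗[F] K) (d * star d) := by
    intro d
    simp
  intro n r hr hsum
  refine h n (fun i => r i ⊗ₜ 1) (fun i hi => hr i ?_) ?_
  · rw [hmap] at hi
    exact hinj (hi.trans (map_zero _).symm)
  · simp only [hmap]
    rw [← map_sum, hsum, map_zero]

theorem mainTheorem10 {F D K : Type*} [Field F] [CharZero F] [StarRing F]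
    [DivisionRing D] [StarRing D] [Algebra F D] [StarModule F D]
    [FiniteDimensional F D] [Algebra.IsCentral F D]
    [Field K] [StarRing K] [Algebra F K] [StarModule F K]
    (ι : K →⋆ₐ[F] D) (hK : IsMaximalStarSubfield ι) :
    ((∃ P : Set F, IsStarOrdering P ∧ hermitianTraceImage F D ⊆ P) →
      ExtendedHermitianTracePosSemidef F D K) ∧
    (ExtendedHermitianTracePosSemidef F D K → HermitianTracePosSemidef F D) ∧
    (HermitianTracePosSemidef F D → IsFormallyRealInvolution (D ⊗[F] K)) ∧
    (IsFormallyRealInvolution (D ⊗[F] K) → IsFormallyRealInvolution D) :=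
  ⟨fun ⟨_, hP, hDP⟩ => extendedHermitianTracePosSemidef_of_isStarOrdering ι hP hDP,
    HermitianTracePosSemidef.of_extended, fun h => h.isFormallyReal_tensor ι,
    IsFormallyRealInvolution.of_tensor⟩
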